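/- Let $n \ge 0$ be an integer and let $R$ be an associative ring with unity that is right coherent (every finitely generated right ideal of $R$ is finitely presented) and left $n$-perfect (every flat left $R$-module has projective dimension at most $n$). Let $G$ be a Gorenstein flat left $R$-module, that is, there is an exact sequence of flat left $R$-modules $\cdots \to F_1 \to F_0 \to F_{-1} \to \cdots$, indexed by $\mathbb{Z}$, that remains exact after applying $A \otimes_R -$ for every injective right $R$-module $A$, and such that $G \cong \ker(F_0 \to F_{-1})$. Let $F$ be a left $R$-module that is flat and cotorsion, where cotorsion means that $\operatorname{Ext}^1_R(K,F)=0$ for every flat left $R$-module $K$. Then $\operatorname{Ext}^i_R(G,F)=0$ for every integer $i \ge 1$. -/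

import Mathlib

open CategoryTheory
open scoped TensorProduct MulOpposite

universe u

/-!  Left `R`-modules are `Module R M`; right `R`-modules are `Module Rᵐᵒᵖ A`, where
`MulOpposite.op r • a` is the product `a r`. -/

namespace GorFlat

/-- The subgroup of `A ⊗[ℤ] M` generated by all `(a r) ⊗ m - a ⊗ (r m)`. -/
def balancedRel (R : Type u) [Ring R] (A : Type u) [AddCommGroup A] [Module Rᵐᵒᵖ A]
    (M : Type u) [AddCommGroup M] [Module R M] : AddSubgroup (A ⊗[ℤ] M) :=
  AddSubgroup.closure {x | ∃ (a : A) (r : R) (m : M),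
    x = (MulOpposite.op r • a) ⊗ₜ[ℤ] m - a ⊗ₜ[ℤ] (r • m)}

/-- The tensor product `A ⊗_R M` of a right `R`-module `A` and a left `R`-module `M` over a
not necessarily commutative ring `R`, an abelian group. -/
abbrev RTensor (R : Type u) [Ring R] (A : Type u) [AddCommGroup A] [Module Rᵐᵒᵖ A]
    (M : Type u) [AddCommGroup M] [Module R M] : Type u :=
  (A ⊗[ℤ] M) ⧸ balancedRel R A M

/-- The pure tensor `a ⊗ m` in `A ⊗_R M`. -/
def tmul (R : Type u) [Ring R] {A : Type u} [AddCommGroup A] [Module Rᵐᵒᵖ A]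
    {M : Type u} [AddCommGroup M] [Module R M] (a : A) (m : M) : RTensor R A M :=
  QuotientAddGroup.mk' (balancedRel R A M) (a ⊗ₜ[ℤ] m)

theorem map_rel (R : Type u) [Ring R]
    {A B : Type u} [AddCommGroup A] [Module Rᵐᵒᵖ A] [AddCommGroup B] [Module Rᵐᵒᵖ B]
    {M N : Type u} [AddCommGroup M] [Module R M] [AddCommGroup N] [Module R N]
    (f : A →ₗ[Rᵐᵒᵖ] B) (g : M →ₗ[R] N) :
    balancedRel R A M ≤ (balancedRel R B N).comap
      (TensorProduct.map f.toAddMonoidHom.toIntLinearMap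
        g.toAddMonoidHom.toIntLinearMap).toAddMonoidHom := by
  refine (AddSubgroup.closure_le _).2 ?_
  rintro _ ⟨a, r, m, rfl⟩
  refine AddSubgroup.subset_closure ⟨f a, r, g m, ?_⟩
  simp

/-- The homomorphism `f ⊗ g : A ⊗_R M → B ⊗_R N`. -/
def map (R : Type u) [Ring R]
    {A B : Type u} [AddCommGroup A] [Module Rᵐᵒᵖ A] [AddCommGroup B] [Module Rᵐᵒᵖ B]
    {M N : Type u} [AddCommGroup M] [Module R M] [AddCommGroup N] [Module R N]
    (f : A →ₗ[Rᵐᵒᵖ] B) (g : M →ₗ[R] N) : RTensor R A M →+ RTensor R B N :=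
  QuotientAddGroup.map (balancedRel R A M) (balancedRel R B N)
    (TensorProduct.map f.toAddMonoidHom.toIntLinearMap
      g.toAddMonoidHom.toIntLinearMap).toAddMonoidHom
    (map_rel R f g)

theorem map_tmul (R : Type u) [Ring R]
    {A B : Type u} [AddCommGroup A] [Module Rᵐᵒᵖ A] [AddCommGroup B] [Module Rᵐᵒᵖ B]
    {M N : Type u} [AddCommGroup M] [Module R M] [AddCommGroup N] [Module R N]
    (f : A →ₗ[Rᵐᵒᵖ] B) (g : M →ₗ[R] N) (a : A) (m : M) :
    map R f g (tmul R a m) = tmul R (f a) (g m) := rfl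

/-- The left `R`-module `M` is flat: `- ⊗_R M` preserves injectivity of homomorphisms of
right `R`-modules. -/
def IsFlat (R : Type u) [Ring R] (M : Type u) [AddCommGroup M] [Module R M] : Prop :=
  ∀ (A B : Type u) [AddCommGroup A] [Module Rᵐᵒᵖ A] [AddCommGroup B] [Module Rᵐᵒᵖ B]
    (f : A →ₗ[Rᵐᵒᵖ] B), Function.Injective f →
      Function.Injective (map R f (LinearMap.id : M →ₗ[R] M))

/-- `R` is right coherent: every finitely generated right ideal is finitely presented. -/
def IsRightCoherent (R : Type u) [Ring R] : Prop :=
  ∀ I : Submodule Rᵐᵒᵖ R, I.FG → Module.FinitePresentation Rᵐᵒᵖ I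

/-- `R` is left `n`-perfect: every flat left `R`-module has projective dimension at most `n`. -/
def IsLeftPerfect (n : ℕ) (R : Type u) [Ring R] : Prop :=
  ∀ (M : Type u) [AddCommGroup M] [Module R M], IsFlat R M →
    HasProjectiveDimensionLE (ModuleCat.of R M) n

/-- The left `R`-module `M` is cotorsion: `Ext^1(K, M) = 0` for every flat left
`R`-module `K`. -/
def IsCotorsion (R : Type u) [Ring R] (M : Type u) [AddCommGroup M] [Module R M] : Prop :=
  ∀ (K : Type u) [AddCommGroup K] [Module R K], IsFlat R K →
    Subsingleton (Abelian.Ext (ModuleCat.of R K) (ModuleCat.of R M) 1)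

/-- The left `R`-module `G` is Gorenstein flat: there is an exact sequence
`⋯ → F₁ → F₀ → F₋₁ → ⋯` of flat left `R`-modules, indexed by `ℤ` and with
`d k : F (k + 1) → F k`, which remains exact after applying `A ⊗_R -` for every injective right
`R`-module `A`, and such that `G` is isomorphic to the kernel of `F₀ → F₋₁`. -/
def IsGorensteinFlat (R : Type u) [Ring R] (G : Type u) [AddCommGroup G] [Module R G] : Prop :=
  ∃ (F : ℤ → ModuleCat.{u} R) (d : ∀ k : ℤ, F (k + 1) →ₗ[R] F k),
    (∀ k, IsFlat R (F k)) ∧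
    (∀ k, Function.Exact (d (k + 1)) (d k)) ∧
    (∀ (A : Type u) [AddCommGroup A] [Module Rᵐᵒᵖ A], Module.Injective Rᵐᵒᵖ A →
      ∀ k, Function.Exact (map R (LinearMap.id : A →ₗ[Rᵐᵒᵖ] A) (d (k + 1)))
        (map R (LinearMap.id : A →ₗ[Rᵐᵒᵖ] A) (d k))) ∧
    Nonempty (G ≃ₗ[R] LinearMap.ker (d (-1)))

end GorFlat

/-! Write `A⁺` for the character module `Hom_ℤ(A, ℚ/ℤ)`, with `ℚ/ℤ` realised as `AddCircle (1 : ℚ)`.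
The proof shows that `F` is a direct summand of `F⁺⁺`, and that `Ext^i(G, A⁺) = 0` for `i ≥ 1` and
every injective right module `A`; the latter applies to `A = F⁺`, which is injective because `F` is
flat.

Splitting: over a right coherent ring the double dual of an injective right module is injective
(`injective_rightDual_leftDual`), so `F⁺⁺⁺` is injective. The dual of `F⁺⁺/F` is a retract of
`F⁺⁺⁺`, so `F⁺⁺/F` is flat (`isFlat_doubleDual_quotient`). As `F` is cotorsion, `F → F⁺⁺` splits.

Vanishing: homomorphisms `M → A⁺` are characters of `A ⊗_R M`. Exactness of `A ⊗_R -` on the flat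
complex, together with divisibility of `ℚ/ℤ`, lets maps into `A⁺` extend. This kills `Ext^1`, and
dimension shifting along the complex does the rest (`ext_leftDual_subsingleton_of_exact`). -/

namespace GorFlat

/-! ### Character modules. -/

/-- The character group of a right module, as a left module. -/
def LeftDual (A : Type u) [AddCommGroup A] : Type u := A →+ AddCircle (1 : ℚ)

/-- The character group of a left module, as a right module. -/
def RightDual (M : Type u) [AddCommGroup M] : Type u := M →+ AddCircle (1 : ℚ)

namespace LeftDual

variable {R : Type u} [Ring R] {A : Type u} [AddCommGroup A] [Module Rᵐᵒᵖ A]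

instance : AddCommGroup (LeftDual A) := inferInstanceAs (AddCommGroup (A →+ AddCircle (1 : ℚ)))

instance : FunLike (LeftDual A) A (AddCircle (1 : ℚ)) :=
  inferInstanceAs (FunLike (A →+ AddCircle (1 : ℚ)) _ _)

instance : AddMonoidHomClass (LeftDual A) A (AddCircle (1 : ℚ)) :=
  inferInstanceAs (AddMonoidHomClass (A →+ AddCircle (1 : ℚ)) _ _)

@[ext] theorem ext {f g : LeftDual A} (h : ∀ a, f a = g a) : f = g := DFunLike.ext _ _ h

@[simp] theorem add_apply (f g : LeftDual A) (a : A) : (f + g) a = f a + g a := rfl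

@[simp] theorem zero_apply (a : A) : (0 : LeftDual A) a = 0 := rfl

/-- Evaluation at an element. -/
def eval (a : A) : LeftDual A →+ AddCircle (1 : ℚ) where
  toFun f := f a
  map_zero' := rfl
  map_add' _ _ := rfl

@[simp] theorem eval_apply (a : A) (f : LeftDual A) : eval a f = f a := rfl

@[simp] theorem sum_apply {ι : Type*} (s : Finset ι) (f : ι → LeftDual A) (a : A) :
    (∑ i ∈ s, f i) a = ∑ i ∈ s, f i a := map_sum (eval a) f s

instance : SMul R (LeftDual A) where
  smul r f := AddMonoidHom.comp f (DistribSMul.toAddMonoidHom A (MulOpposite.op r))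

@[simp] theorem smul_apply (r : R) (f : LeftDual A) (a : A) :
    (r • f) a = f (MulOpposite.op r • a) := rfl

instance : Module R (LeftDual A) where
  one_smul f := by ext a; simp
  mul_smul r s f := by ext a; simp [mul_smul]
  smul_zero r := by ext a; simp
  smul_add r f g := by ext a; simp
  add_smul r s f := by ext a; simp [add_smul]
  zero_smul f := by ext a; simp

end LeftDual

namespace RightDual

variable {R : Type u} [Ring R] {M : Type u} [AddCommGroup M] [Module R M]

instance : AddCommGroup (RightDual M) := inferInstanceAs (AddCommGroup (M →+ AddCircle (1 : ℚ)))

instance : FunLike (RightDual M) M (AddCircle (1 : ℚ)) :=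
  inferInstanceAs (FunLike (M →+ AddCircle (1 : ℚ)) _ _)

instance : AddMonoidHomClass (RightDual M) M (AddCircle (1 : ℚ)) :=
  inferInstanceAs (AddMonoidHomClass (M →+ AddCircle (1 : ℚ)) _ _)

@[ext] theorem ext {f g : RightDual M} (h : ∀ a, f a = g a) : f = g := DFunLike.ext _ _ h

@[simp] theorem add_apply (f g : RightDual M) (a : M) : (f + g) a = f a + g a := rfl

@[simp] theorem zero_apply (a : M) : (0 : RightDual M) a = 0 := rfl

/-- Evaluation at an element. -/
def eval (a : M) : RightDual M →+ AddCircle (1 : ℚ) where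
  toFun f := f a
  map_zero' := rfl
  map_add' _ _ := rfl

@[simp] theorem eval_apply (a : M) (f : RightDual M) : eval a f = f a := rfl

@[simp] theorem sum_apply {ι : Type*} (s : Finset ι) (f : ι → RightDual M) (a : M) :
    (∑ i ∈ s, f i) a = ∑ i ∈ s, f i a := map_sum (eval a) f s

instance : SMul Rᵐᵒᵖ (RightDual M) where
  smul r f := AddMonoidHom.comp f (DistribSMul.toAddMonoidHom M r.unop)

@[simp] theorem smul_apply (r : Rᵐᵒᵖ) (f : RightDual M) (a : M) :
    (r • f) a = f (r.unop • a) := rfl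

instance : Module Rᵐᵒᵖ (RightDual M) where
  one_smul f := by ext a; simp
  mul_smul r s f := by ext a; simp [mul_smul]
  smul_zero r := by ext a; simp
  smul_add r f g := by ext a; simp
  add_smul r s f := by ext a; simp [add_smul]
  zero_smul f := by ext a; simp

end RightDual

/-- `q` descends to `X / ker p`, which embeds in `Y`, and the divisible group `ℚ/ℤ` is injective. -/
theorem exists_character_extension {X Y : Type*} [AddCommGroup X] [AddCommGroup Y]
    (p : X →+ Y) (q : X →+ AddCircle (1 : ℚ)) (h : ∀ x, p x = 0 → q x = 0) :
    ∃ c : Y →+ AddCircle (1 : ℚ), ∀ x, c (p x) = q x := by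
  obtain ⟨c, hc⟩ := (Module.Baer.of_divisible (AddCircle (1 : ℚ))).extension_property_addMonoidHom
    (QuotientAddGroup.kerLift p) (QuotientAddGroup.kerLift_injective p)
    (QuotientAddGroup.lift p.ker q h)
  exact ⟨c, fun x => DFunLike.congr_fun hc (QuotientAddGroup.mk' p.ker x)⟩

/-! ### Tensor-hom adjunction for characters. -/

section Tensor

variable {R : Type u} [Ring R] {A : Type u} [AddCommGroup A] [Module Rᵐᵒᵖ A]
  {M : Type u} [AddCommGroup M] [Module R M]

/-- The homomorphism out of `A ⊗_R M` induced by a balanced biadditive map. -/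
noncomputable def lift {D : Type*} [AddCommGroup D] (φ : A →+ M →+ D)
    (h : ∀ (a : A) (r : R) (m : M), φ (MulOpposite.op r • a) m = φ a (r • m)) :
    RTensor R A M →+ D :=
  QuotientAddGroup.lift (balancedRel R A M)
    (TensorProduct.liftAddHom φ fun z a m => by simp) (by
      refine (AddSubgroup.closure_le _).2 ?_
      rintro _ ⟨a, r, m, rfl⟩
      change TensorProduct.liftAddHom φ _ _ = 0
      rw [map_sub, TensorProduct.liftAddHom_tmul, TensorProduct.liftAddHom_tmul, h, sub_self])

theorem addHom_ext {D : Type*} [AddCommGroup D] {f g : RTensor R A M →+ D}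
    (h : ∀ a m, f (tmul R a m) = g (tmul R a m)) : f = g := by
  refine QuotientAddGroup.addMonoidHom_ext _ ?_
  ext x
  induction x with
  | zero => simp
  | tmul a m => exact h a m
  | add x y hx hy => rw [map_add, map_add, hx, hy]

/-- The pure tensors, as a biadditive map. -/
def tmulHom (R : Type u) [Ring R] (A : Type u) [AddCommGroup A] [Module Rᵐᵒᵖ A]
    (M : Type u) [AddCommGroup M] [Module R M] : A →+ M →+ RTensor R A M :=
  AddMonoidHom.mk' (fun a => AddMonoidHom.mk' (tmul R a) fun m m' => by
      simp only [tmul, TensorProduct.tmul_add, map_add])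
    fun a a' => by
      ext m
      change tmul R (a + a') m = tmul R a m + tmul R a' m
      simp only [tmul, TensorProduct.add_tmul, map_add]

theorem tmul_add (a : A) (m m' : M) : tmul R a (m + m') = tmul R a m + tmul R a m' :=
  map_add (tmulHom R A M a) m m'

theorem add_tmul (a a' : A) (m : M) : tmul R (a + a') m = tmul R a m + tmul R a' m :=
  DFunLike.congr_fun (map_add (tmulHom R A M) a a') m

theorem op_smul_tmul (a : A) (r : R) (m : M) :
    tmul R (MulOpposite.op r • a) m = tmul R a (r • m) := by
  rw [← sub_eq_zero, tmul, tmul, ← map_sub]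
  exact (QuotientAddGroup.eq_zero_iff _).2 (AddSubgroup.subset_closure ⟨a, r, m, rfl⟩)

/-- The character of `A ⊗_R M` attached to a homomorphism from `M` to the dual of `A`. -/
noncomputable def uncurryLeft (f : M →ₗ[R] LeftDual A) : RTensor R A M →+ AddCircle (1 : ℚ) :=
  lift (AddMonoidHom.mk' (fun a => (LeftDual.eval a).comp f.toAddMonoidHom) fun a b => by
    ext m; simp) fun a r m => by simp

@[simp] theorem uncurryLeft_tmul (f : M →ₗ[R] LeftDual A) (a : A) (m : M) :
    uncurryLeft f (tmul R a m) = f m a := rfl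

/-- The homomorphism from `M` to the dual of `A` attached to a character of `A ⊗_R M`. -/
def curryLeft (c : RTensor R A M →+ AddCircle (1 : ℚ)) : M →ₗ[R] LeftDual A where
  toFun m := AddMonoidHom.mk' (fun a => c (tmul R a m)) fun a b => by rw [add_tmul, map_add]
  map_add' m n := LeftDual.ext fun a => by
    change c _ = c _ + c _
    rw [tmul_add, map_add]
  map_smul' r m := LeftDual.ext fun a => by
    change c _ = c _
    rw [← op_smul_tmul]; rfl

/-- The character of `A ⊗_R M` attached to a homomorphism from `A` to the dual of `M`. -/
noncomputable def uncurryRight (f : A →ₗ[Rᵐᵒᵖ] RightDual M) :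
    RTensor R A M →+ AddCircle (1 : ℚ) :=
  lift (AddMonoidHom.mk' (fun a => (f a : M →+ AddCircle (1 : ℚ))) fun a b => map_add f a b)
    fun a r m => by
      change f _ m = f _ _
      rw [map_smul]; rfl

@[simp] theorem uncurryRight_tmul (f : A →ₗ[Rᵐᵒᵖ] RightDual M) (a : A) (m : M) :
    uncurryRight f (tmul R a m) = f a m := rfl

/-- The homomorphism from `A` to the dual of `M` attached to a character of `A ⊗_R M`. -/
def curryRight (c : RTensor R A M →+ AddCircle (1 : ℚ)) : A →ₗ[Rᵐᵒᵖ] RightDual M where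
  toFun a := AddMonoidHom.mk' (fun m => c (tmul R a m)) fun a b => by rw [tmul_add, map_add]
  map_add' m n := RightDual.ext fun a => by
    change c _ = c _ + c _
    rw [add_tmul, map_add]
  map_smul' r m := RightDual.ext fun a => by
    change c _ = c _
    exact congrArg c (op_smul_tmul m r.unop a)

@[simp] theorem curryRight_apply (c : RTensor R A M →+ AddCircle (1 : ℚ)) (m : M) (a : A) :
    curryRight c a m = c (tmul R a m) := rfl

end Tensor

/-! ### Flatness, injectivity of duals, and coherence. -/

section Flat

variable {R : Type u} [Ring R]

/-- One half of Lambek's criterion: a map `X → M⁺` is a character of `X ⊗_R M`, which extends along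
the injection into `Y ⊗_R M`. -/
theorem injective_rightDual_of_isFlat (M : Type u) [AddCommGroup M] [Module R M]
    (hM : IsFlat R M) : Module.Injective Rᵐᵒᵖ (RightDual M) where
  out X Y _ _ _ _ f hf g := by
    obtain ⟨c, hc⟩ := exists_character_extension (map R f (LinearMap.id : M →ₗ[R] M))
      (uncurryRight g) fun x hx => by
        rw [(injective_iff_map_eq_zero _).1 (hM X Y f hf) x hx, map_zero]
    refine ⟨curryRight c, fun x => RightDual.ext fun m => ?_⟩
    simpa [map_tmul] using hc (tmul R x m)

/-- The other half: every character of `X ⊗_R M` factors through `Y ⊗_R M`, and characters separate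
points. -/
theorem isFlat_of_injective_rightDual (M : Type u) [AddCommGroup M] [Module R M]
    (hM : Module.Injective Rᵐᵒᵖ (RightDual M)) : IsFlat R M := by
  intro X Y _ _ _ _ f hf
  refine (injective_iff_map_eq_zero _).2 fun t ht => ?_
  by_contra hne
  obtain ⟨c, hc⟩ := CharacterModule.exists_character_apply_ne_zero_of_ne_zero hne
  let c' : RTensor R X M →+ AddCircle (1 : ℚ) := c
  obtain ⟨g, hg⟩ := hM.out f hf (curryRight c')
  have key : (uncurryRight g).comp (map R f LinearMap.id) = c' :=
    addHom_ext fun a m => by simp [map_tmul, hg]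
  apply hc
  change c' t = 0
  rw [← key, AddMonoidHom.comp_apply, ht, map_zero]

/-- The hypothesis makes `x i ↦ a i` well defined on the right ideal generated by the `x i`. By
injectivity it extends to `R`, and `b` is the image of `1`. -/
theorem exists_eq_op_smul_of_relations {A : Type u} [AddCommGroup A] [Module Rᵐᵒᵖ A]
    (hA : Module.Injective Rᵐᵒᵖ A) {ι : Type u} [Fintype ι] (x : ι → R) (a : ι → A)
    (h : ∀ c : ι → Rᵐᵒᵖ, ∑ i, c i • x i = 0 → ∑ i, c i • a i = 0) :
    ∃ b : A, ∀ i, a i = MulOpposite.op (x i) • b := by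
  classical
  let p : (ι → Rᵐᵒᵖ) →ₗ[Rᵐᵒᵖ] R := Fintype.linearCombination Rᵐᵒᵖ x
  let q : (ι → Rᵐᵒᵖ) →ₗ[Rᵐᵒᵖ] A := Fintype.linearCombination Rᵐᵒᵖ a
  have hpq : LinearMap.ker p ≤ LinearMap.ker q := fun c hc => h c hc
  obtain ⟨g, hg⟩ := hA.out ((LinearMap.ker p).liftQ p le_rfl)
    (LinearMap.ker_eq_bot.1 (Submodule.ker_liftQ_eq_bot _ _ _ le_rfl))
    ((LinearMap.ker p).liftQ q hpq)
  refine ⟨g 1, fun i => ?_⟩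
  have := hg (Submodule.Quotient.mk (Pi.single i 1))
  simp only [Submodule.liftQ_apply, p, q, Fintype.linearCombination_apply_single, one_smul] at this
  rw [← this, ← map_smul]
  simp

/-- This is the equational form of flatness of `A⁺`: the relation `∑ x i • φ i = 0` is a consequence
of relations among the `x i` alone. These are finitely generated by coherence, and `y` satisfies
them. -/
theorem sum_apply_eq_zero_of_isRightCoherent (hcoh : IsRightCoherent R)
    {A : Type u} [AddCommGroup A] [Module Rᵐᵒᵖ A]
    (hA : Module.Injective Rᵐᵒᵖ A) {ι : Type u} [Fintype ι] (x : ι → R) (φ : ι → LeftDual A)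
    (hφ : ∑ i, x i • φ i = 0) (y : ι → RightDual (LeftDual A))
    (hy : ∀ c : ι → Rᵐᵒᵖ, ∑ i, c i • x i = 0 → ∑ i, c i • y i = 0) :
    ∑ i, y i (φ i) = 0 := by
  classical
  let π : (ι → Rᵐᵒᵖ) →ₗ[Rᵐᵒᵖ] R := Fintype.linearCombination Rᵐᵒᵖ x
  -- The one use of coherence: the relations among the `x i` have a finite generating family `κ`.
  have : Module.FinitePresentation Rᵐᵒᵖ (LinearMap.range π) := hcoh _ (Submodule.fg_range π)
  have hfg : (LinearMap.ker π).FG := by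
    rw [← LinearMap.ker_rangeRestrict]
    exact Module.FinitePresentation.fg_ker _ π.surjective_rangeRestrict
  obtain ⟨k, κ, hκ⟩ := Submodule.fg_iff_exists_fin_generating_family.1 hfg
  let ρ : (ι → A) →+ (Fin k → A) := AddMonoidHom.mk' (fun a l => ∑ j, κ l j • a j) fun a b => by
    ext l; simp [Finset.sum_add_distrib]
  let Φ : (ι → A) →+ AddCircle (1 : ℚ) := AddMonoidHom.mk' (fun a => ∑ j, φ j (a j)) fun a b => by
    simp [Finset.sum_add_distrib]
  have hΦ : ∀ a, ρ a = 0 → Φ a = 0 := by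
    intro a ha
    let q : (ι → Rᵐᵒᵖ) →ₗ[Rᵐᵒᵖ] A := Fintype.linearCombination Rᵐᵒᵖ a
    have hq : LinearMap.ker π ≤ LinearMap.ker q := by
      rw [← hκ, Submodule.span_le]
      rintro _ ⟨l, rfl⟩
      exact congrFun ha l
    -- A tuple satisfying all the relations is `a i = b (x i)`, so `Φ a` is the value of `∑ x i • φ
    -- i = 0` at `b`.
    obtain ⟨b, hb⟩ := exists_eq_op_smul_of_relations hA x a fun c hc => hq hc
    have := DFunLike.congr_fun hφ b
    simpa [Φ, hb] using this
  obtain ⟨ψ, hψ⟩ := exists_character_extension ρ Φ hΦ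
  -- A character of the finite product `A^k` is the sum of its restrictions to the factors; this
  -- writes `φ` in terms of `κ`.
  let χ : Fin k → LeftDual A := fun l => ψ.comp (AddMonoidHom.single (fun _ => A) l)
  have hχ : ∀ j, φ j = ∑ l, (κ l j).unop • χ l := by
    intro j
    ext a
    have h1 : Φ (Pi.single j a) = φ j a := by
      change ∑ i, φ i ((Pi.single j a : ι → A) i) = _
      rw [Finset.sum_eq_single j (fun i _ hi => by rw [Pi.single_eq_of_ne hi, map_zero])
        (by simp), Pi.single_eq_same]
    have h2 : ρ (Pi.single j a) = ∑ l, Pi.single l (κ l j • a) := by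
      rw [Finset.univ_sum_single fun l => κ l j • a]
      ext l
      change ∑ i, κ l i • (Pi.single j a : ι → A) i = _
      rw [Finset.sum_eq_single j (fun i _ hi => by rw [Pi.single_eq_of_ne hi, smul_zero])
        (by simp), Pi.single_eq_same]
    rw [← h1, ← hψ, h2, map_sum, LeftDual.sum_apply]
    rfl
  have hrel : ∀ l, ∑ j, κ l j • y j = 0 := fun l =>
    hy _ (show κ l ∈ LinearMap.ker π from hκ ▸ Submodule.subset_span ⟨l, rfl⟩)
  calc ∑ j, y j (φ j) = ∑ j, ∑ l, (κ l j • y j) (χ l) := by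
        refine Finset.sum_congr rfl fun j _ => ?_
        rw [hχ, map_sum]; rfl
    _ = ∑ l, (∑ j, κ l j • y j) (χ l) := by
        rw [Finset.sum_comm]; simp
    _ = 0 := by simp [hrel]

/-- By Baer's criterion it suffices to find a character `c` of `A⁺` with `c (x φ) = g x φ` for `x`
in the ideal. Any formal sum involves finitely many `x`, so the preceding lemma shows that this
prescription is consistent. -/
theorem injective_rightDual_leftDual (hcoh : IsRightCoherent R)
    {A : Type u} [AddCommGroup A] [Module Rᵐᵒᵖ A] (hA : Module.Injective Rᵐᵒᵖ A) :
    Module.Injective Rᵐᵒᵖ (RightDual (LeftDual A)) := by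
  refine Module.Baer.injective fun I g => ?_
  let p : (I →₀ LeftDual A) →+ LeftDual A :=
    Finsupp.liftAddHom fun x => DistribSMul.toAddMonoidHom (LeftDual A) x.1.unop
  let q : (I →₀ LeftDual A) →+ AddCircle (1 : ℚ) :=
    Finsupp.liftAddHom fun x => (g x : LeftDual A →+ AddCircle (1 : ℚ))
  obtain ⟨c, hc⟩ := exists_character_extension p q fun t ht => by
    have h := sum_apply_eq_zero_of_isRightCoherent hcoh hA
      (fun i : t.support => i.1.1.unop) (fun i => t i.1)
      (by rw [Finset.sum_coe_sort t.support fun i => i.1.unop • t i]; exact ht)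
      (fun i => g i.1) fun c hc => by
        have h0 : ∑ i, c i • i.1 = 0 := by
          apply Subtype.ext
          apply MulOpposite.unop_injective
          simpa using hc
        rw [← map_zero g, ← h0, map_sum]
        simp
    rw [Finset.sum_coe_sort t.support fun i => g i (t i)] at h
    exact h
  let c' : RightDual (LeftDual A) := c
  refine ⟨LinearMap.toSpanSingleton Rᵐᵒᵖ _ c', fun x hx => RightDual.ext fun φ => ?_⟩
  have hp : p (Finsupp.single ⟨x, hx⟩ φ) = x.unop • φ := Finsupp.liftAddHom_apply_single _ _ _
  calc c (x.unop • φ) = c (p (Finsupp.single ⟨x, hx⟩ φ)) := by rw [hp]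
    _ = q (Finsupp.single ⟨x, hx⟩ φ) := hc _
    _ = g ⟨x, hx⟩ φ := Finsupp.liftAddHom_apply_single _ _ _

end Flat

/-! ### Double duals and exactness of duality. -/

section Duals

variable {R : Type u} [Ring R]

/-- Precomposition with a homomorphism of right modules. -/
def LeftDual.map {A B : Type u} [AddCommGroup A] [Module Rᵐᵒᵖ A] [AddCommGroup B] [Module Rᵐᵒᵖ B]
    (f : A →ₗ[Rᵐᵒᵖ] B) : LeftDual B →ₗ[R] LeftDual A where
  toFun c := AddMonoidHom.comp c f.toAddMonoidHom
  map_add' _ _ := rfl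
  map_smul' r c := LeftDual.ext fun a => congrArg c (map_smul f (MulOpposite.op r) a).symm

@[simp] theorem LeftDual.map_apply {A B : Type u} [AddCommGroup A] [Module Rᵐᵒᵖ A]
    [AddCommGroup B] [Module Rᵐᵒᵖ B] (f : A →ₗ[Rᵐᵒᵖ] B) (c : LeftDual B) (a : A) :
    LeftDual.map (R := R) f c a = c (f a) := rfl

/-- Precomposition with a homomorphism of left modules. -/
def RightDual.map {M N : Type u} [AddCommGroup M] [Module R M] [AddCommGroup N] [Module R N]
    (f : M →ₗ[R] N) : RightDual N →ₗ[Rᵐᵒᵖ] RightDual M where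
  toFun c := AddMonoidHom.comp c f.toAddMonoidHom
  map_add' _ _ := rfl
  map_smul' r c := RightDual.ext fun a => congrArg c (map_smul f r.unop a).symm

@[simp] theorem RightDual.map_apply {M N : Type u} [AddCommGroup M] [Module R M]
    [AddCommGroup N] [Module R N] (f : M →ₗ[R] N) (c : RightDual N) (a : M) :
    RightDual.map f c a = c (f a) := rfl

/-- The canonical map of a left module to its double dual. -/
def doubleDual (R : Type u) [Ring R] (M : Type u) [AddCommGroup M] [Module R M] :
    M →ₗ[R] LeftDual (RightDual M) where
  toFun m := RightDual.eval m
  map_add' m n := LeftDual.ext fun c => map_add c m n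
  map_smul' _ _ := rfl

theorem doubleDual_injective (M : Type u) [AddCommGroup M] [Module R M] :
    Function.Injective (doubleDual R M) := by
  refine (injective_iff_map_eq_zero _).2 fun m hm => ?_
  by_contra hne
  obtain ⟨c, hc⟩ := CharacterModule.exists_character_apply_ne_zero_of_ne_zero hne
  exact hc (DFunLike.congr_fun hm (c : RightDual M))

/-- The canonical map of a right module to its double dual. -/
def doubleDualRight (R : Type u) [Ring R] (A : Type u) [AddCommGroup A] [Module Rᵐᵒᵖ A] :
    A →ₗ[Rᵐᵒᵖ] RightDual (LeftDual A) where
  toFun m := LeftDual.eval m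
  map_add' m n := RightDual.ext fun c => map_add c m n
  map_smul' _ _ := rfl

/-- The projection of the triple dual of `M` onto the dual of the cokernel of `M → M⁺⁺`. -/
def tripleDualProj (R : Type u) [Ring R] (M : Type u) [AddCommGroup M] [Module R M] :
    RightDual (LeftDual (RightDual M)) →ₗ[Rᵐᵒᵖ]
      RightDual (LeftDual (RightDual M) ⧸ LinearMap.range (doubleDual R M)) where
  -- Subtracting the character of `M⁺⁺` induced by the restriction of `t` to `M` leaves one that
  -- vanishes on `M`.
  toFun t := QuotientAddGroup.lift (LinearMap.range (doubleDual R M)).toAddSubgroup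
    (t - doubleDualRight R (RightDual M) (RightDual.map (doubleDual R M) t) :
      LeftDual (RightDual M) →+ AddCircle (1 : ℚ)) (by
        rintro _ ⟨m, rfl⟩
        exact sub_self _)
  map_add' t t' := RightDual.ext fun x => by
    obtain ⟨x, rfl⟩ := Submodule.mkQ_surjective _ x
    change t x + t' x - doubleDualRight R _ (RightDual.map (doubleDual R M) (t + t')) x =
      t x - doubleDualRight R _ (RightDual.map (doubleDual R M) t) x +
        (t' x - doubleDualRight R _ (RightDual.map (doubleDual R M) t') x)
    rw [map_add, map_add]
    exact add_sub_add_comm _ _ _ _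
  map_smul' r t := RightDual.ext fun x => by
    obtain ⟨x, rfl⟩ := Submodule.mkQ_surjective _ x
    rfl

/-- A character pulled back from the cokernel vanishes on `M`, so its correction term is zero. Hence
the dual of the cokernel is a retract of the triple dual. -/
theorem tripleDualProj_map_mkQ (M : Type u) [AddCommGroup M] [Module R M]
    (c : RightDual (LeftDual (RightDual M) ⧸ LinearMap.range (doubleDual R M))) :
    tripleDualProj R M (RightDual.map (LinearMap.range (doubleDual R M)).mkQ c) = c := by
  ext x
  obtain ⟨x, rfl⟩ := Submodule.mkQ_surjective _ x
  have h0 : RightDual.map (doubleDual R M)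
      (RightDual.map (LinearMap.range (doubleDual R M)).mkQ c) = 0 := by
    ext m
    have : (LinearMap.range (doubleDual R M)).mkQ (doubleDual R M m) = 0 := by simp
    rw [RightDual.map_apply, RightDual.map_apply, this, map_zero, RightDual.zero_apply]
  change c _ - doubleDualRight R (RightDual M) (RightDual.map (doubleDual R M)
      (RightDual.map (LinearMap.range (doubleDual R M)).mkQ c)) x = _
  rw [h0, map_zero, RightDual.zero_apply, sub_zero]
  rfl

theorem isFlat_doubleDual_quotient (hcoh : IsRightCoherent R) (M : Type u) [AddCommGroup M]
    [Module R M] (hM : IsFlat R M) :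
    IsFlat R (LeftDual (RightDual M) ⧸ LinearMap.range (doubleDual R M)) := by
  have hinj := injective_rightDual_leftDual hcoh (injective_rightDual_of_isFlat M hM)
  refine isFlat_of_injective_rightDual _ ⟨fun X Y _ _ _ _ f hf g => ?_⟩
  obtain ⟨h, hh⟩ := hinj.out f hf
    ((RightDual.map (LinearMap.range (doubleDual R M)).mkQ).comp g)
  refine ⟨(tripleDualProj R M).comp h, fun x => ?_⟩
  rw [LinearMap.comp_apply, hh, LinearMap.comp_apply, tripleDualProj_map_mkQ]

/-- An element of the dual of a free module is a family of characters of the ring, so a map `g` into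
it amounts to the characters `m ↦ g m e_x`. Each extends separately to `N`, as `c x`. -/
theorem injective_leftDual_finsupp (R : Type u) [Ring R] (X : Type u) :
    Module.Injective R (LeftDual (X →₀ Rᵐᵒᵖ)) where
  out M N _ _ _ _ f hf g := by
    have hext (x : X) := exists_character_extension f.toAddMonoidHom
      ((LeftDual.eval (Finsupp.single x (1 : Rᵐᵒᵖ))).comp g.toAddMonoidHom) fun m hm => by
        rw [(injective_iff_map_eq_zero f).1 hf m hm, map_zero]
    choose c hc using hext
    let h (n : N) : LeftDual (X →₀ Rᵐᵒᵖ) := Finsupp.liftAddHom fun x =>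
      AddMonoidHom.mk' (fun t : Rᵐᵒᵖ => c x (t.unop • n)) fun s t => by simp [add_smul]
    have h_single (n : N) (x : X) (t : Rᵐᵒᵖ) : h n (Finsupp.single x t) = c x (t.unop • n) :=
      Finsupp.liftAddHom_apply_single _ _ _
    have h_ext {a b : LeftDual (X →₀ Rᵐᵒᵖ)}
        (hab : ∀ x t, a (Finsupp.single x t) = b (Finsupp.single x t)) : a = b :=
      Finsupp.addHom_ext (f := (a : (X →₀ Rᵐᵒᵖ) →+ AddCircle (1 : ℚ))) (g := b) hab
    refine ⟨{ toFun := h, map_add' := fun m n => h_ext fun x t => ?_,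
              map_smul' := fun r n => h_ext fun x t => ?_ }, fun m => h_ext fun x t => ?_⟩
    · rw [LeftDual.add_apply, h_single, h_single, h_single, smul_add, map_add]
    · rw [RingHom.id_apply, LeftDual.smul_apply, Finsupp.smul_single, h_single, h_single]
      simp [mul_smul]
    · change h (f m) _ = _
      rw [h_single, ← map_smul]
      refine (hc x _).trans ?_
      change g (t.unop • m) _ = _
      rw [map_smul, LeftDual.smul_apply]
      simp

theorem LeftDual.map_surjective {A B : Type u} [AddCommGroup A] [Module Rᵐᵒᵖ A]
    [AddCommGroup B] [Module Rᵐᵒᵖ B] (f : A →ₗ[Rᵐᵒᵖ] B) (hf : Function.Injective f) :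
    Function.Surjective (LeftDual.map (R := R) f) := by
  intro c
  obtain ⟨d, hd⟩ := exists_character_extension f.toAddMonoidHom
    (c : A →+ AddCircle (1 : ℚ)) fun a ha => by
      rw [(injective_iff_map_eq_zero f).1 hf a ha]
      exact map_zero c
  exact ⟨d, LeftDual.ext hd⟩

theorem LeftDual.map_injective {A B : Type u} [AddCommGroup A] [Module Rᵐᵒᵖ A]
    [AddCommGroup B] [Module Rᵐᵒᵖ B] (f : A →ₗ[Rᵐᵒᵖ] B) (hf : Function.Surjective f) :
    Function.Injective (LeftDual.map (R := R) f) := by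
  intro c d hcd
  ext b
  obtain ⟨a, rfl⟩ := hf b
  exact DFunLike.congr_fun hcd a

theorem LeftDual.map_exact {A B C : Type u} [AddCommGroup A] [Module Rᵐᵒᵖ A]
    [AddCommGroup B] [Module Rᵐᵒᵖ B] [AddCommGroup C] [Module Rᵐᵒᵖ C]
    (f : A →ₗ[Rᵐᵒᵖ] B) (g : B →ₗ[Rᵐᵒᵖ] C) (hfg : Function.Exact f g) :
    Function.Exact (LeftDual.map (R := R) g) (LeftDual.map (R := R) f) := by
  intro c
  constructor
  · intro hc
    obtain ⟨d, hd⟩ := exists_character_extension g.toAddMonoidHom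
      (c : B →+ AddCircle (1 : ℚ)) fun b hb => by
        obtain ⟨a, rfl⟩ := (hfg b).1 hb
        exact DFunLike.congr_fun hc a
    exact ⟨d, LeftDual.ext hd⟩
  · rintro ⟨d, rfl⟩
    ext a
    simp [hfg.apply_apply_eq_zero]

end Duals

/-! ### Long exact sequences and dimension shifting for `Ext`. -/

section Ext

variable {R : Type u} [Ring R] {X Y Z : Type u} [AddCommGroup X] [Module R X]
  [AddCommGroup Y] [Module R Y] [AddCommGroup Z] [Module R Z] {f : X →ₗ[R] Y} {g : Y →ₗ[R] Z}

theorem shortExact_of_exact (hf : Function.Injective f) (hg : Function.Surjective g)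
    (hfg : Function.Exact f g) :
    (ModuleCat.shortComplexOfCompEqZero f g hfg.linearMap_comp_eq_zero).ShortExact :=
  ModuleCat.shortComplex_shortExact _ hfg hf hg

/-- Every class comes from some `k : X → N` under the connecting map, which kills those `k` that
extend to `Y`. -/
theorem ext_one_subsingleton_of_extends (hf : Function.Injective f) (hg : Function.Surjective g)
    (hfg : Function.Exact f g) (N : Type u) [AddCommGroup N] [Module R N]
    [Subsingleton (Abelian.Ext (ModuleCat.of R Y) (ModuleCat.of R N) 1)]
    (h : ∀ k : X →ₗ[R] N, ∃ l : Y →ₗ[R] N, l.comp f = k) :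
    Subsingleton (Abelian.Ext (ModuleCat.of R Z) (ModuleCat.of R N) 1) := by
  have hS := shortExact_of_exact hf hg hfg
  refine subsingleton_of_forall_eq 0 fun e => ?_
  obtain ⟨x, hx⟩ := Abelian.Ext.contravariant_sequence_exact₃ hS _ e
    (Subsingleton.elim (α := Abelian.Ext (ModuleCat.of R Y) (ModuleCat.of R N) 1) _ _)
    (n₀ := 0) rfl
  obtain ⟨k, rfl⟩ := Abelian.Ext.addEquiv₀.symm.surjective x
  obtain ⟨l, hl⟩ := h k.hom
  have hk : k = ModuleCat.ofHom f ≫ ModuleCat.ofHom l := by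
    rw [← ModuleCat.ofHom_comp, hl]; rfl
  rw [← hx, hk, Abelian.Ext.addEquiv₀_symm_apply, ← Abelian.Ext.mk₀_comp_mk₀]
  exact hS.extClass_comp_assoc _

theorem ext_one_subsingleton_of_lifts (hf : Function.Injective f) (hg : Function.Surjective g)
    (hfg : Function.Exact f g) (M : Type u) [AddCommGroup M] [Module R M]
    [Subsingleton (Abelian.Ext (ModuleCat.of R M) (ModuleCat.of R Y) 1)]
    (h : ∀ k : M →ₗ[R] Z, ∃ l : M →ₗ[R] Y, g.comp l = k) :
    Subsingleton (Abelian.Ext (ModuleCat.of R M) (ModuleCat.of R X) 1) := by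
  have hS := shortExact_of_exact hf hg hfg
  refine subsingleton_of_forall_eq 0 fun e => ?_
  obtain ⟨x, hx⟩ := Abelian.Ext.covariant_sequence_exact₁ _ hS e
    (Subsingleton.elim (α := Abelian.Ext (ModuleCat.of R M) (ModuleCat.of R Y) 1) _ _)
    (n₀ := 0) rfl
  obtain ⟨k, rfl⟩ := Abelian.Ext.addEquiv₀.symm.surjective x
  obtain ⟨l, hl⟩ := h k.hom
  have hk : k = ModuleCat.ofHom l ≫ ModuleCat.ofHom g := by
    rw [← ModuleCat.ofHom_comp, hl]; rfl
  rw [← hx, hk, Abelian.Ext.addEquiv₀_symm_apply, ← Abelian.Ext.mk₀_comp_mk₀,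
    Abelian.Ext.comp_assoc_of_second_deg_zero]
  rw [hS.comp_extClass, Abelian.Ext.comp_zero]

theorem ext_succ_subsingleton_right (hf : Function.Injective f) (hg : Function.Surjective g)
    (hfg : Function.Exact f g) (N : Type u) [AddCommGroup N] [Module R N] (i : ℕ)
    [Subsingleton (Abelian.Ext (ModuleCat.of R X) (ModuleCat.of R N) i)]
    [Subsingleton (Abelian.Ext (ModuleCat.of R Y) (ModuleCat.of R N) (i + 1))] :
    Subsingleton (Abelian.Ext (ModuleCat.of R Z) (ModuleCat.of R N) (i + 1)) := by
  have hS := shortExact_of_exact hf hg hfg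
  refine subsingleton_of_forall_eq 0 fun e => ?_
  obtain ⟨x, hx⟩ := Abelian.Ext.contravariant_sequence_exact₃ hS _ e
    (Subsingleton.elim (α := Abelian.Ext (ModuleCat.of R Y) (ModuleCat.of R N) (i + 1)) _ _)
    (n₀ := i) (add_comm _ _)
  rw [← hx, Subsingleton.elim (α := Abelian.Ext (ModuleCat.of R X) (ModuleCat.of R N) i) x 0]
  exact Abelian.Ext.comp_zero hS.extClass _ _ _ _

theorem ext_succ_subsingleton_left (hf : Function.Injective f) (hg : Function.Surjective g)
    (hfg : Function.Exact f g) (M : Type u) [AddCommGroup M] [Module R M] (i : ℕ)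
    [Subsingleton (Abelian.Ext (ModuleCat.of R M) (ModuleCat.of R Z) i)]
    [Subsingleton (Abelian.Ext (ModuleCat.of R M) (ModuleCat.of R Y) (i + 1))] :
    Subsingleton (Abelian.Ext (ModuleCat.of R M) (ModuleCat.of R X) (i + 1)) := by
  have hS := shortExact_of_exact hf hg hfg
  refine subsingleton_of_forall_eq 0 fun e => ?_
  obtain ⟨x, hx⟩ := Abelian.Ext.covariant_sequence_exact₁ _ hS e
    (Subsingleton.elim (α := Abelian.Ext (ModuleCat.of R M) (ModuleCat.of R Y) (i + 1)) _ _)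
    (n₀ := i) rfl
  rw [← hx, Subsingleton.elim (α := Abelian.Ext (ModuleCat.of R M) (ModuleCat.of R Z) i) x 0]
  exact Abelian.Ext.zero_comp _ _ hS.extClass _ _

theorem exists_extension_of_ext_one_subsingleton (hf : Function.Injective f)
    (hg : Function.Surjective g) (hfg : Function.Exact f g) (N : Type u) [AddCommGroup N]
    [Module R N] [Subsingleton (Abelian.Ext (ModuleCat.of R Z) (ModuleCat.of R N) 1)]
    (k : X →ₗ[R] N) : ∃ l : Y →ₗ[R] N, l.comp f = k := by
  have hS := shortExact_of_exact hf hg hfg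
  obtain ⟨x, hx⟩ := Abelian.Ext.contravariant_sequence_exact₁ hS _
    (Abelian.Ext.mk₀ (ModuleCat.ofHom k)) (n₁ := 1) rfl
    (Subsingleton.elim (α := Abelian.Ext (ModuleCat.of R Z) (ModuleCat.of R N) 1) _ _)
  obtain ⟨l, rfl⟩ := Abelian.Ext.addEquiv₀.symm.surjective x
  rw [Abelian.Ext.addEquiv₀_symm_apply, Abelian.Ext.mk₀_comp_mk₀] at hx
  have := (Abelian.Ext.mk₀_bijective _ _).1 hx
  exact ⟨l.hom, congrArg ModuleCat.Hom.hom this⟩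

theorem ext_subsingleton_of_retract (M : Type u) [AddCommGroup M] [Module R M]
    (s : X →ₗ[R] Y) (r : Y →ₗ[R] X) (hrs : r.comp s = LinearMap.id) (i : ℕ)
    [Subsingleton (Abelian.Ext (ModuleCat.of R M) (ModuleCat.of R Y) i)] :
    Subsingleton (Abelian.Ext (ModuleCat.of R M) (ModuleCat.of R X) i) := by
  refine subsingleton_of_forall_eq 0 fun e => ?_
  have hid : ModuleCat.ofHom s ≫ ModuleCat.ofHom r = 𝟙 (ModuleCat.of R X) := by
    rw [← ModuleCat.ofHom_comp, hrs]; rfl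
  rw [← Abelian.Ext.comp_mk₀_id e, ← hid, ← Abelian.Ext.mk₀_comp_mk₀,
    ← Abelian.Ext.comp_assoc_of_third_deg_zero,
    Subsingleton.elim (e.comp (Abelian.Ext.mk₀ (ModuleCat.ofHom s)) _) 0,
    Abelian.Ext.zero_comp]

theorem ext_subsingleton_of_linearEquiv (N : Type u) [AddCommGroup N] [Module R N]
    (e : X ≃ₗ[R] Y) (i : ℕ)
    [Subsingleton (Abelian.Ext (ModuleCat.of R Y) (ModuleCat.of R N) i)] :
    Subsingleton (Abelian.Ext (ModuleCat.of R X) (ModuleCat.of R N) i) := by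
  refine subsingleton_of_forall_eq 0 fun a => ?_
  rw [← Abelian.Ext.mk₀_id_comp a, ← e.toModuleIso.hom_inv_id, ← Abelian.Ext.mk₀_comp_mk₀,
    Abelian.Ext.comp_assoc_of_second_deg_zero,
    Subsingleton.elim ((Abelian.Ext.mk₀ e.toModuleIso.inv).comp a _) 0, Abelian.Ext.comp_zero]

end Ext

/-! ### Vanishing of `Ext` into character modules, and the splitting. -/

section Vanishing

variable {R : Type u} [Ring R]

/-- Dualising a free cover `Q → A` embeds `A⁺` in an injective module whose cokernel `(ker p)⁺` is
again a dual, which permits induction over all duals. -/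
theorem exists_surjective_injective_leftDual (R : Type u) [Ring R] (A : Type u) [AddCommGroup A]
    [Module Rᵐᵒᵖ A] : ∃ (Q : Type u) (_ : AddCommGroup Q) (_ : Module Rᵐᵒᵖ Q)
      (p : Q →ₗ[Rᵐᵒᵖ] A), Function.Surjective p ∧ Injective (ModuleCat.of R (LeftDual Q)) :=
  ⟨A →₀ Rᵐᵒᵖ, inferInstance, inferInstance, Finsupp.linearCombination Rᵐᵒᵖ id,
    Finsupp.linearCombination_id_surjective Rᵐᵒᵖ A,
    (Module.injective_iff_injective_object R _).1 (injective_leftDual_finsupp R A)⟩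

theorem ext_leftDual_subsingleton_of_isFlat (K : Type u) [AddCommGroup K] [Module R K]
    (hK : IsFlat R K) (i : ℕ) (A : Type u) [AddCommGroup A] [Module Rᵐᵒᵖ A] :
    Subsingleton (Abelian.Ext (ModuleCat.of R K) (ModuleCat.of R (LeftDual A)) (i + 1)) := by
  induction i generalizing A with
  | zero =>
    obtain ⟨Q, _, _, p, hp, _⟩ := exists_surjective_injective_leftDual R A
    have := Abelian.Ext.subsingleton_of_injective (ModuleCat.of R K)
      (ModuleCat.of R (LeftDual Q)) 0
    refine ext_one_subsingleton_of_lifts (LeftDual.map_injective p hp)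
      (LeftDual.map_surjective (LinearMap.ker p).subtype Subtype.val_injective)
      (LeftDual.map_exact _ p (LinearMap.exact_subtype_ker_map p)) K fun k => ?_
    -- A map `K → (ker p)⁺` is a character of `ker p ⊗_R K`; flatness of `K` makes it extend to `Q
    -- ⊗_R K`.
    obtain ⟨c, hc⟩ := exists_character_extension
      (map R (LinearMap.ker p).subtype (LinearMap.id : K →ₗ[R] K)) (uncurryLeft k) fun x hx => by
        rw [(injective_iff_map_eq_zero _).1 (hK _ _ _ Subtype.val_injective) x hx, map_zero]
    exact ⟨curryLeft c, LinearMap.ext fun m => LeftDual.ext fun b => hc (tmul R b m)⟩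
  | succ i ih =>
    obtain ⟨Q, _, _, p, hp, _⟩ := exists_surjective_injective_leftDual R A
    have := Abelian.Ext.subsingleton_of_injective (ModuleCat.of R K)
      (ModuleCat.of R (LeftDual Q)) (i + 1)
    have := ih (LinearMap.ker p)
    exact ext_succ_subsingleton_left (LeftDual.map_injective p hp)
      (LeftDual.map_surjective (LinearMap.ker p).subtype Subtype.val_injective)
      (LeftDual.map_exact _ p (LinearMap.exact_subtype_ker_map p)) K (i + 1)

/-- Each kernel sits in `0 → ker d (k+1) → F (k+2) → ker d k → 0` with flat middle term, so only
`Ext^1` needs an argument; higher degrees shift to the next kernel. -/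
theorem ext_leftDual_subsingleton_of_exact {A : Type u} [AddCommGroup A] [Module Rᵐᵒᵖ A]
    (F : ℤ → ModuleCat.{u} R) (d : ∀ k : ℤ, F (k + 1) →ₗ[R] F k) (hF : ∀ k, IsFlat R (F k))
    (hd : ∀ k, Function.Exact (d (k + 1)) (d k))
    (hA : ∀ k, Function.Exact (map R (LinearMap.id : A →ₗ[Rᵐᵒᵖ] A) (d (k + 1)))
        (map R (LinearMap.id : A →ₗ[Rᵐᵒᵖ] A) (d k))) (i : ℕ) (k : ℤ) :
    Subsingleton (Abelian.Ext (ModuleCat.of R (LinearMap.ker (d k)))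
      (ModuleCat.of R (LeftDual A)) (i + 1)) := by
  have hsurj (k : ℤ) (x : LinearMap.ker (d k)) : ∃ y, d (k + 1) y = x :=
    (hd k x).1 x.2
  let g (k : ℤ) : F (k + 1 + 1) →ₗ[R] LinearMap.ker (d k) :=
    (d (k + 1)).codRestrict _ fun y => (hd k).apply_apply_eq_zero y
  have hg (k : ℤ) : Function.Surjective (g k) := fun x => by
    obtain ⟨y, hy⟩ := hsurj k x
    exact ⟨y, Subtype.ext hy⟩
  have hfg (k : ℤ) : Function.Exact (LinearMap.ker (d (k + 1))).subtype (g k) := by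
    rw [LinearMap.exact_iff, Submodule.range_subtype]
    exact LinearMap.ker_codRestrict _ _ _
  induction i generalizing k with
  | zero =>
    have := ext_leftDual_subsingleton_of_isFlat (F (k + 1 + 1)) (hF _) 0 A
    refine ext_one_subsingleton_of_extends Subtype.val_injective (hg k) (hfg k) (LeftDual A)
      fun l => ?_
    -- Pulled back to `F (k+3)`, `l` becomes a character of `A ⊗_R F (k+3)` that vanishes on the
    -- image of `A ⊗_R F (k+4)`. By exactness this image is the kernel of the map to `A ⊗_R F
    -- (k+2)`, so the character extends there.
    obtain ⟨c, hc⟩ := exists_character_extension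
      (map R (LinearMap.id : A →ₗ[Rᵐᵒᵖ] A) (d (k + 1 + 1)))
      (uncurryLeft (l.comp (g (k + 1)))) fun x hx => by
        obtain ⟨y, rfl⟩ := (hA _ x).1 hx
        have h0 : (uncurryLeft (l.comp (g (k + 1)))).comp
            (map R (LinearMap.id : A →ₗ[Rᵐᵒᵖ] A) (d (k + 1 + 1 + 1))) = 0 := by
          refine addHom_ext fun a m => ?_
          have : g (k + 1) (d (k + 1 + 1 + 1) m) = 0 :=
            Subtype.ext ((hd _).apply_apply_eq_zero m)
          rw [AddMonoidHom.comp_apply, map_tmul, uncurryLeft_tmul, LinearMap.comp_apply, this,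
            map_zero]
          rfl
        exact DFunLike.congr_fun h0 y
    refine ⟨curryLeft c, LinearMap.ext fun z => LeftDual.ext fun a => ?_⟩
    obtain ⟨y, rfl⟩ := hg (k + 1) z
    exact hc (tmul R a y)
  | succ i ih =>
    have := ih (k + 1)
    have := ext_leftDual_subsingleton_of_isFlat (F (k + 1 + 1)) (hF _) (i + 1) A
    exact ext_succ_subsingleton_right Subtype.val_injective (hg k) (hfg k) (LeftDual A) (i + 1)

theorem exists_retraction_doubleDual (hcoh : IsRightCoherent R) (F : Type u) [AddCommGroup F]
    [Module R F] (hflat : IsFlat R F) (hcot : IsCotorsion R F) :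
    ∃ r : LeftDual (RightDual F) →ₗ[R] F, r.comp (doubleDual R F) = LinearMap.id := by
  -- `Ext^1(F⁺⁺/F, F) = 0` lets the identity of `F` extend to `F⁺⁺`.
  have := hcot _ (isFlat_doubleDual_quotient hcoh F hflat)
  exact exists_extension_of_ext_one_subsingleton (doubleDual_injective F)
    (Submodule.mkQ_surjective (LinearMap.range (doubleDual R F)))
    (LinearMap.exact_map_mkQ_range _) F LinearMap.id

end Vanishing

end GorFlat

theorem lemma2 (R : Type u) [Ring R] (n : ℕ)
    (hcoh : GorFlat.IsRightCoherent R) (hperf : GorFlat.IsLeftPerfect n R)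
    (G : Type u) [AddCommGroup G] [Module R G] (hG : GorFlat.IsGorensteinFlat R G)
    (F : Type u) [AddCommGroup F] [Module R F]
    (hflat : GorFlat.IsFlat R F) (hcot : GorFlat.IsCotorsion R F)
    (i : ℕ) (hi : 1 ≤ i) :
    Subsingleton (Abelian.Ext (ModuleCat.of R G) (ModuleCat.of R F) i) := by
  obtain ⟨j, rfl⟩ := Nat.exists_eq_add_of_le' hi
  obtain ⟨T, d, hT, hd, hA, ⟨e⟩⟩ := hG
  obtain ⟨r, hr⟩ := GorFlat.exists_retraction_doubleDual hcoh F hflat hcot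
  have := GorFlat.ext_leftDual_subsingleton_of_exact T d hT hd
    (hA (GorFlat.RightDual F) (GorFlat.injective_rightDual_of_isFlat F hflat)) j (-1)
  have := GorFlat.ext_subsingleton_of_linearEquiv (GorFlat.LeftDual (GorFlat.RightDual F)) e (j + 1)
  exact GorFlat.ext_subsingleton_of_retract G (GorFlat.doubleDual R F) r hr (j + 1)
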